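/- Let $n,q$ be positive integers. In the 3-shift-sum problem the input is a $3\times n$ table $x$ with entries in $\mathbb{Z}/q\mathbb{Z}$, given by query access to its $3n$ entries. The input is positive if its rows can be circularly shifted so that every column sums to zero, i.e. if there are $b,c\in\mathbb{Z}/n\mathbb{Z}$ such that $x_{1,i}+x_{2,i+b}+x_{3,i+c}=0$ in $\mathbb{Z}/q\mathbb{Z}$ for all $i\in\mathbb{Z}/n\mathbb{Z}$ (columns are indexed by $\mathbb{Z}/n\mathbb{Z}$). It is negative if $x_{1,i}+x_{2,j}+x_{3,k}\neq 0$ in $\mathbb{Z}/q\mathbb{Z}$ for all columns $i,j,k$. The task is to decide, with error probability at most $1/3$, whether the input is positive or negative, under the promise that one of the two holds. **Theorem.** Assume $q\ge 2n^3$. Then the (bounded-error) quantum query complexity of the 3-shift-sum problem is $\Omega(n^{1/3})$. That is, there is an absolute constant $c>0$ such that for all positive integers $n$ and $q$ with $q\ge 2n^3$, every quantum query algorithm that solves the 3-shift-sum problem makes at least $c\,n^{1/3}$ queries. -/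

import Mathlib

open scoped ENNReal Matrix

/-- The computational basis of the state space of a quantum query algorithm: an index register
ranging over the input variables, an answer register ranging over the alphabet `ZMod q`, and a
workspace register of finite dimension `m`. -/
abbrev QueryBasis (ι : Type*) (q m : ℕ) : Type _ := ι × ZMod q × Fin m

/-- A quantum query algorithm on inputs `x : ι → ZMod q`. It starts in the basis state `init`,
applies the input-independent unitaries `unitary 0, …, unitary queries`, with one query to the
input between any two consecutive ones, then measures in the computational basis and accepts
if the outcome lies in `accept`. (The unitaries with index above `queries` play no role.) -/
structure QuantumQueryAlgorithm (ι : Type*) [Fintype ι] [DecidableEq ι] (q : ℕ) [NeZero q] where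
  /-- dimension of the workspace register -/
  workspace : ℕ
  /-- number of queries -/
  queries : ℕ
  /-- the initial basis state -/
  init : QueryBasis ι q workspace
  /-- the input-independent unitaries -/
  unitary : ℕ → Matrix.unitaryGroup (QueryBasis ι q workspace) ℂ
  /-- the accepting measurement outcomes -/
  accept : Finset (QueryBasis ι q workspace)

/-- The query operator of the input `x`, the linear map given on basis states by
`|i, b, w⟩ ↦ |i, b + x i, w⟩`. -/
def queryOracle {ι : Type*} {q m : ℕ} (x : ι → ZMod q) (ψ : QueryBasis ι q m → ℂ) :
    QueryBasis ι q m → ℂ :=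
  fun s => ψ (s.1, s.2.1 - x s.1, s.2.2)

namespace QuantumQueryAlgorithm

variable {ι : Type*} [Fintype ι] [DecidableEq ι] {q : ℕ} [NeZero q]

/-- The state of the algorithm on input `x` after `t` queries and `t + 1` unitaries. -/
noncomputable def state (A : QuantumQueryAlgorithm ι q) (x : ι → ZMod q) :
    ℕ → QueryBasis ι q A.workspace → ℂ
  | 0 => (A.unitary 0).1 *ᵥ Pi.single A.init 1
  | t + 1 => (A.unitary (t + 1)).1 *ᵥ queryOracle x (state A x t)

/-- The probability that the algorithm accepts the input `x`. -/
noncomputable def acceptProb (A : QuantumQueryAlgorithm ι q) (x : ι → ZMod q) : ℝ :=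
  ∑ s ∈ A.accept, ‖A.state x A.queries s‖ ^ 2

/-- The algorithm solves, with error probability at most `1/3`, the promise problem with positive
inputs `pos` and negative inputs `neg`. -/
def Solves (A : QuantumQueryAlgorithm ι q) (pos neg : Set (ι → ZMod q)) : Prop :=
  (∀ x ∈ pos, 2 / 3 ≤ A.acceptProb x) ∧ (∀ x ∈ neg, A.acceptProb x ≤ 1 / 3)

end QuantumQueryAlgorithm

/-- The bounded-error quantum query complexity of a promise problem: the least number of queries
of a quantum query algorithm that solves it (`⊤` if there were none). -/
noncomputable def quantumQueryComplexity {ι : Type*} [Fintype ι] [DecidableEq ι] {q : ℕ} [NeZero q]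
    (pos neg : Set (ι → ZMod q)) : ℕ∞ :=
  ⨅ (A : QuantumQueryAlgorithm ι q) (_ : A.Solves pos neg), (A.queries : ℕ∞)

/-- Positive inputs of the 3-shift-sum problem: tables with `3` rows and `n` columns whose rows can
be shifted circularly so that each column sums to zero modulo `q`. Addition in `Fin n` is
modulo `n`. -/
def threeShiftSumPos (n q : ℕ) : Set (Fin 3 × Fin n → ZMod q) :=
  {x | ∃ b c : Fin n, ∀ i : Fin n, x (0, i) + x (1, i + b) + x (2, i + c) = 0}

/-- Negative inputs of the 3-shift-sum problem: no three elements, one from each row, sum to zero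
modulo `q`. -/
def threeShiftSumNeg (n q : ℕ) : Set (Fin 3 × Fin n → ZMod q) :=
  {x | ∀ i j k : Fin n, x (0, i) + x (1, j) + x (2, k) ≠ 0}

/-! The proof is a negative-weight adversary bound (`le_queries_of_kernelBound`). Given a kernel `G`
between positive and negative inputs, the number of queries is at least a constant times the norm of
`G` divided by the largest norm of the kernels `G r y * (1 - e(k * (r i - y i)))`, where `e` is the
standard additive character of `ZMod q`, `i` a cell and `k` a frequency.

The kernel is diagonal in characters. For a shift `m`, let `H m` be the group of tables whose
columns sum to zero after shifting by `m`. The block of `m` sends the normalized character `κ` on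
all tables to its normalized restriction to `H m`, times a coefficient `a m κ`. Only characters with
at most one nonzero cell in each shifted column are used; they remain distinct, hence orthonormal,
on `H m` (`distinctOn_sparseChars`). The squared norm is then at most the maximum over `κ` of `∑ m,
a m κ ^ 2`. A query merely translates `κ` by `k` in the cell `i`.

With `R = ⌊n^(1/3)⌋`, the coefficient is `(R - |supp κ|)⁺ / n` on sparse characters and zero
elsewhere. The trivial character has `∑ m, a m 0 ^ 2 = R ^ 2`, which makes the norm at least a
constant times `R`: restricting to negative inputs costs only a constant factor, since `q ≥ 2 n ^ 3`
makes half of all tables negative (`card_le_two_mul_card_neg`). Under a query the support size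
changes by at most one, contributing at most `n ^ 2 * (1 / n ^ 2) = 1`; sparsity is gained or lost
only if the queried cell is aligned with one of fewer than `R` support cells, each for at most `n`
shifts, contributing at most `R * n * (R / n) ^ 2 = R ^ 3 / n ≤ 1` (`sum_adversaryCoeff_sub_sq_le`).
So the query kernels have bounded norm. -/

open scoped ComplexConjugate

/-! ### Kernels and their operator norms. -/

/-- The sesquilinear form with kernel `G`. -/
noncomputable def kernelForm {R Y : Type*} [Fintype R] [Fintype Y] (G : R → Y → ℂ)
    (f : R → ℂ) (g : Y → ℂ) : ℂ :=
  ∑ r, ∑ y, conj (f r) * G r y * g y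

/-- The kernel `G` has `ℓ²` operator norm at most `C`. -/
def KernelBound {R Y : Type*} [Fintype R] [Fintype Y] (G : R → Y → ℂ) (C : ℝ) : Prop :=
  ∀ (f : R → ℂ) (g : Y → ℂ),
    ‖kernelForm G f g‖ ≤ C * (√(∑ r, ‖f r‖ ^ 2) * √(∑ y, ‖g y‖ ^ 2))

section KernelBound

variable {R Y : Type*} [Fintype R] [Fintype Y] {G H : R → Y → ℂ} {C D : ℝ}

theorem kernelForm_smul_smul (G : R → Y → ℂ) (f : R → ℂ) (g : Y → ℂ) (a b : ℝ) :
    kernelForm G (fun r => a * f r) (fun y => b * g y) = a * b * kernelForm G f g := by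
  simp only [kernelForm, Finset.mul_sum, map_mul, Complex.conj_ofReal]
  refine Finset.sum_congr rfl fun r _ => Finset.sum_congr rfl fun y _ => ?_
  ring

theorem KernelBound.add (hG : KernelBound G C) (hH : KernelBound H D) :
    KernelBound (fun r y => G r y + H r y) (C + D) := by
  intro f g
  have h : kernelForm (fun r y => G r y + H r y) f g = kernelForm G f g + kernelForm H f g := by
    simp only [kernelForm, ← Finset.sum_add_distrib, mul_add, add_mul]
  rw [h, add_mul]
  exact (norm_add_le _ _).trans (add_le_add (hG f g) (hH f g))

/-- Extend `g` by zero. This is what allows the kernel to be analysed on all tables and then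
restricted to the negative ones. -/
theorem KernelBound.comp_injective {Y' : Type*} [Fintype Y'] (hG : KernelBound G C)
    {v : Y' → Y} (hv : Function.Injective v) : KernelBound (fun r y => G r (v y)) C := by
  classical
  intro f g
  have hext : ∀ y, Function.extend v g 0 (v y) = g y := fun y => hv.extend_apply g 0 y
  have h0 : ∀ y, y ∉ Set.range v → Function.extend v g 0 y = 0 := fun y hy => by
    rw [Function.extend_apply' _ _ _ (by simpa using hy)]; rfl
  have h := hG f (Function.extend v g 0)
  have h1 : kernelForm (fun r y => G r (v y)) f g = kernelForm G f (Function.extend v g 0) :=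
    Finset.sum_congr rfl fun r _ => Fintype.sum_of_injective v hv _ _
      (fun y hy => by rw [h0 y hy, mul_zero]) fun y => by rw [hext]
  have h2 : ∑ y, ‖g y‖ ^ 2 = ∑ y, ‖Function.extend v g 0 y‖ ^ 2 :=
    Fintype.sum_of_injective v hv _ _ (fun y hy => by rw [h0 y hy]; simp) fun y => by rw [hext]
  rw [h1, h2]
  exact h

/-- AM-GM with a free weight `a`, which makes the bound linear in the squared norms and so summable
over basis states. -/
theorem KernelBound.norm_le_weighted (hG : KernelBound G C) (hC : 0 ≤ C) (f : R → ℂ) (g : Y → ℂ)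
    {a : ℝ} (ha : 0 < a) :
    ‖kernelForm G f g‖ ≤ C * ((a⁻¹ * ∑ r, ‖f r‖ ^ 2 + a * ∑ y, ‖g y‖ ^ 2) / 2) := by
  refine (hG f g).trans (mul_le_mul_of_nonneg_left ?_ hC)
  set F := ∑ r, ‖f r‖ ^ 2
  set E := ∑ y, ‖g y‖ ^ 2
  have hF : 0 ≤ F := by positivity
  have hE : 0 ≤ E := by positivity
  have h1 : √F * √E = √(a⁻¹ * F) * √(a * E) := by
    rw [← Real.sqrt_mul hF, ← Real.sqrt_mul (by positivity)]
    congr 1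
    field_simp
  rw [h1]
  have h2 := Real.sq_sqrt (show 0 ≤ a⁻¹ * F by positivity)
  have h3 := Real.sq_sqrt (show 0 ≤ a * E by positivity)
  nlinarith [sq_nonneg (√(a⁻¹ * F) - √(a * E))]

/-- Near-extremal unit vectors of a kernel, with the (positive) norm that they almost attain. -/
theorem exists_kernelBound_near_extremal (G : R → Y → ℂ) {f₁ : R → ℂ} {g₁ : Y → ℂ} {K₁ θ : ℝ}
    (hC : KernelBound G C) (hθ : θ < 1) (hK₁ : 0 < K₁)
    (hf₁ : ∑ r, ‖f₁ r‖ ^ 2 = 1) (hg₁ : ∑ y, ‖g₁ y‖ ^ 2 = 1) (h₁ : K₁ ≤ ‖kernelForm G f₁ g₁‖) :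
    ∃ K, K₁ ≤ K ∧ KernelBound G K ∧ ∃ (f : R → ℂ) (g : Y → ℂ),
      ∑ r, ‖f r‖ ^ 2 = 1 ∧ ∑ y, ‖g y‖ ^ 2 = 1 ∧ θ * K ≤ ‖kernelForm G f g‖ := by
  let S : Set ℝ := {k | ∃ (f : R → ℂ) (g : Y → ℂ),
      ∑ r, ‖f r‖ ^ 2 = 1 ∧ ∑ y, ‖g y‖ ^ 2 = 1 ∧ k = ‖kernelForm G f g‖}
  have hbdd : BddAbove S := by
    refine ⟨C, ?_⟩
    rintro k ⟨f, g, hf, hg, rfl⟩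
    simpa [hf, hg] using hC f g
  have hmem : ‖kernelForm G f₁ g₁‖ ∈ S := ⟨f₁, g₁, hf₁, hg₁, rfl⟩
  have hK : K₁ ≤ sSup S := h₁.trans (le_csSup hbdd hmem)
  refine ⟨sSup S, hK, ?_, ?_⟩
  · intro f g
    have hf0 : 0 ≤ ∑ r, ‖f r‖ ^ 2 := by positivity
    have hg0 : 0 ≤ ∑ y, ‖g y‖ ^ 2 := by positivity
    -- Zero vectors cannot be normalized; for them the form vanishes by the a priori bound `hC`.
    rcases hf0.eq_or_lt with hf | hf
    · have h := hC f g
      rw [← hf] at h ⊢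
      simpa using h
    rcases hg0.eq_or_lt with hg | hg
    · have h := hC f g
      rw [← hg] at h ⊢
      simpa using h
    set F := ∑ r, ‖f r‖ ^ 2 with hF
    set E := ∑ y, ‖g y‖ ^ 2 with hE
    have hsF : 0 < √F := Real.sqrt_pos.2 hf
    have hsE : 0 < √E := Real.sqrt_pos.2 hg
    have hu : ‖kernelForm G (fun r => ((√F)⁻¹ : ℝ) * f r) (fun y => ((√E)⁻¹ : ℝ) * g y)‖ ∈ S := by
      refine ⟨_, _, ?_, ?_, rfl⟩
      · simp only [norm_mul, mul_pow, ← Finset.mul_sum, ← hF, Complex.norm_real, Real.norm_eq_abs,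
          sq_abs, inv_pow, Real.sq_sqrt hf.le]
        exact inv_mul_cancel₀ hf.ne'
      · simp only [norm_mul, mul_pow, ← Finset.mul_sum, ← hE, Complex.norm_real, Real.norm_eq_abs,
          sq_abs, inv_pow, Real.sq_sqrt hg.le]
        exact inv_mul_cancel₀ hg.ne'
    have h := le_csSup hbdd hu
    rw [kernelForm_smul_smul, norm_mul, norm_mul, Complex.norm_real, Complex.norm_real,
      Real.norm_of_nonneg (inv_nonneg.2 hsF.le), Real.norm_of_nonneg (inv_nonneg.2 hsE.le)] at h
    calc ‖kernelForm G f g‖ = ((√F)⁻¹ * (√E)⁻¹ * ‖kernelForm G f g‖) * (√F * √E) := by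
          field_simp
      _ ≤ _ := by gcongr
  · have hpos : 0 < sSup S := hK₁.trans_le hK
    obtain ⟨k, ⟨f, g, hf, hg, rfl⟩, hk⟩ :=
      exists_lt_of_lt_csSup ⟨_, hmem⟩ (show θ * sSup S < sSup S by nlinarith)
    exact ⟨f, g, hf, hg, hk.le⟩

end KernelBound

/-! ### Parseval's identity on the alphabet. -/

section Fourier

variable {q : ℕ} [NeZero q]

/-- Parseval's identity on `ZMod q`, for the Fourier transforms of two shifted functions. -/
theorem sum_conj_shift_mul_shift (u v : ZMod q → ℂ) (x y : ZMod q) :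
    (q : ℂ) * ∑ b, conj (u (b - x)) * v (b - y) =
      ∑ k, ZMod.stdAddChar (k * (x - y)) *
        (conj (∑ b, ZMod.stdAddChar (-(k * b)) * u b) *
          ∑ b, ZMod.stdAddChar (-(k * b)) * v b) := by
  have h : ∀ k : ZMod q, ZMod.stdAddChar (k * (x - y)) *
        (conj (∑ b, ZMod.stdAddChar (-(k * b)) * u b) *
          ∑ b, ZMod.stdAddChar (-(k * b)) * v b) =
      ∑ b, ∑ c, ZMod.stdAddChar (k * (x + b - (y + c))) * (conj (u b) * v c) := by
    intro k
    rw [map_sum, Finset.sum_mul_sum, Finset.mul_sum]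
    refine Finset.sum_congr rfl fun b _ => ?_
    rw [Finset.mul_sum]
    refine Finset.sum_congr rfl fun c _ => ?_
    have e : k * (x + b - (y + c)) = k * (x - y) + k * b + -(k * c) := by ring
    rw [map_mul (starRingEnd ℂ), e, AddChar.map_add_eq_mul, AddChar.map_add_eq_mul,
      ← AddChar.map_neg_eq_conj, neg_neg]
    ring
  rw [Finset.sum_congr rfl fun k _ => h k, Finset.sum_comm,
    ← Equiv.sum_comp (Equiv.addRight x) (fun b => conj (u (b - x)) * v (b - y)), Finset.mul_sum]
  refine Finset.sum_congr rfl fun b _ => ?_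
  rw [Finset.sum_comm, Finset.sum_eq_single (x + b - y)]
  · rw [← Finset.sum_mul, AddChar.sum_mulShift _ (ZMod.isPrimitive_stdAddChar q), if_pos (by ring)]
    simp [ZMod.card, add_comm]
  · intro c _ hc
    rw [← Finset.sum_mul, AddChar.sum_mulShift _ (ZMod.isPrimitive_stdAddChar q), if_neg,
      Nat.cast_zero, zero_mul]
    intro h0
    apply hc
    linear_combination -h0
  · simp

end Fourier

/-! ### Inner products of algorithm states, with the answer register in the Fourier basis. -/

namespace QuantumQueryAlgorithm

section AnswerTransform

variable {ι : Type*} [Fintype ι] {q : ℕ} [NeZero q]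

/-- The Fourier transform of a state in its answer register. -/
noncomputable def answerTransform {m : ℕ} (ψ : QueryBasis ι q m → ℂ) :
    QueryBasis ι q m → ℂ :=
  fun s => ∑ b, ZMod.stdAddChar (-(s.2.1 * b)) * ψ (s.1, b, s.2.2)

theorem sum_queryOracle_mul_queryOracle {m : ℕ} (x y : ι → ZMod q) (φ ψ : QueryBasis ι q m → ℂ) :
    (q : ℂ) * ∑ s, conj (queryOracle x φ s) * queryOracle y ψ s =
      ∑ s : QueryBasis ι q m, ZMod.stdAddChar (s.2.1 * (x s.1 - y s.1)) *
        (conj (answerTransform φ s) * answerTransform ψ s) := by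
  simp only [Fintype.sum_prod_type, queryOracle, answerTransform]
  rw [Finset.mul_sum]
  refine Finset.sum_congr rfl fun i _ => ?_
  rw [Finset.sum_comm, Finset.mul_sum]
  conv_rhs => rw [Finset.sum_comm]
  refine Finset.sum_congr rfl fun w _ => ?_
  exact sum_conj_shift_mul_shift (fun b => φ (i, b, w)) (fun b => ψ (i, b, w)) (x i) (y i)

theorem sum_mul_eq_sum_answerTransform {m : ℕ} (φ ψ : QueryBasis ι q m → ℂ) :
    (q : ℂ) * ∑ s, conj (φ s) * ψ s = ∑ s, conj (answerTransform φ s) * answerTransform ψ s := by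
  simpa [queryOracle] using sum_queryOracle_mul_queryOracle (0 : ι → ZMod q) 0 φ ψ

end AnswerTransform

variable {ι : Type*} [Fintype ι] [DecidableEq ι] {q : ℕ} [NeZero q]

/-- The inner product of the states on the inputs `x` and `y` after `t` queries. -/
noncomputable def stateInner (A : QuantumQueryAlgorithm ι q) (x y : ι → ZMod q) (t : ℕ) : ℂ :=
  ∑ s, conj (A.state x t s) * A.state y t s

theorem sum_conj_unitary_mulVec {n : Type*} [Fintype n] [DecidableEq n]
    (U : Matrix.unitaryGroup n ℂ) (φ ψ : n → ℂ) :
    ∑ s, conj ((U.1 *ᵥ φ) s) * (U.1 *ᵥ ψ) s = ∑ s, conj (φ s) * ψ s := by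
  change star (U.1 *ᵥ φ) ⬝ᵥ (U.1 *ᵥ ψ) = star φ ⬝ᵥ ψ
  rw [Matrix.star_mulVec, Matrix.dotProduct_mulVec, Matrix.vecMul_vecMul,
    ← Matrix.star_eq_conjTranspose, Matrix.UnitaryGroup.star_mul_self, Matrix.vecMul_one]

theorem stateInner_zero (A : QuantumQueryAlgorithm ι q) (x y : ι → ZMod q) :
    A.stateInner x y 0 = 1 := by
  simp only [stateInner, state, sum_conj_unitary_mulVec]
  simp [Pi.single_apply]

theorem stateInner_succ (A : QuantumQueryAlgorithm ι q) (x y : ι → ZMod q) (t : ℕ) :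
    A.stateInner x y (t + 1) =
      ∑ s, conj (queryOracle x (A.state x t) s) * queryOracle y (A.state y t) s := by
  simp only [stateInner, state, sum_conj_unitary_mulVec]

theorem stateInner_self (A : QuantumQueryAlgorithm ι q) (x : ι → ZMod q) (t : ℕ) :
    A.stateInner x x t = 1 := by
  induction t with
  | zero => exact A.stateInner_zero x x
  | succ t ih =>
    have hq : (q : ℂ) ≠ 0 := Nat.cast_ne_zero.2 (NeZero.ne q)
    refine mul_left_cancel₀ hq ?_
    rw [stateInner_succ, sum_queryOracle_mul_queryOracle, ← ih, stateInner,
      sum_mul_eq_sum_answerTransform]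
    simp

theorem ofReal_sum_norm_sq {n : Type*} [Fintype n] (φ : n → ℂ) :
    ((∑ s, ‖φ s‖ ^ 2 : ℝ) : ℂ) = ∑ s, conj (φ s) * φ s := by
  push_cast
  exact Finset.sum_congr rfl fun s _ => (Complex.conj_mul' _).symm

theorem sum_norm_sq_state (A : QuantumQueryAlgorithm ι q) (x : ι → ZMod q) (t : ℕ) :
    ∑ s, ‖A.state x t s‖ ^ 2 = 1 := by
  have h := A.stateInner_self x t
  rw [stateInner, ← ofReal_sum_norm_sq] at h
  exact_mod_cast h

theorem sum_norm_sq_answerTransform_state (A : QuantumQueryAlgorithm ι q) (x : ι → ZMod q)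
    (t : ℕ) : ∑ s, ‖answerTransform (A.state x t) s‖ ^ 2 = q := by
  have h := A.stateInner_self x t
  have h2 := sum_mul_eq_sum_answerTransform (A.state x t) (A.state x t)
  rw [stateInner] at h
  rw [h, ← ofReal_sum_norm_sq, mul_one] at h2
  exact_mod_cast h2.symm

theorem sum_norm_sq_mul_answerTransform {Z : Type*} [Fintype Z] (A : QuantumQueryAlgorithm ι q)
    (ζ : Z → ι → ZMod q) (t : ℕ) (h : Z → ℂ) (hh : ∑ z, ‖h z‖ ^ 2 = 1) :
    ∑ s, ∑ z, ‖h z * answerTransform (A.state (ζ z) t) s‖ ^ 2 = q := by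
  rw [Finset.sum_comm]
  simp only [norm_mul, mul_pow, ← Finset.mul_sum, sum_norm_sq_answerTransform_state]
  rw [← Finset.sum_mul, hh, one_mul]

/-! ### The adversary bound. -/

section Adversary

variable {R Y : Type*} [Fintype R] [Fintype Y]

/-- The change of the progress in one query is bounded by the kernels of the single queries. -/
theorem norm_progress_sub_le (A : QuantumQueryAlgorithm ι q) (ρ : R → ι → ZMod q)
    (υ : Y → ι → ZMod q) (G : R → Y → ℂ) {L : ℝ} (hL0 : 0 ≤ L)
    (hL : ∀ (i : ι) (k : ZMod q),
      KernelBound (fun r y => G r y * (1 - ZMod.stdAddChar (k * (ρ r i - υ y i)))) L)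
    (f : R → ℂ) (g : Y → ℂ) (hf : ∑ r, ‖f r‖ ^ 2 = 1) (hg : ∑ y, ‖g y‖ ^ 2 = 1) (t : ℕ) :
    ‖∑ r, ∑ y, conj (f r) * (G r y * A.stateInner (ρ r) (υ y) t) * g y -
      ∑ r, ∑ y, conj (f r) * (G r y * A.stateInner (ρ r) (υ y) (t + 1)) * g y‖ ≤ L := by
  have hq0 : (0 : ℝ) < q := Nat.cast_pos.2 (NeZero.pos q)
  set W := ∑ r, ∑ y, conj (f r) * (G r y * A.stateInner (ρ r) (υ y) t) * g y -
      ∑ r, ∑ y, conj (f r) * (G r y * A.stateInner (ρ r) (υ y) (t + 1)) * g y with hW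
  -- In the Fourier basis of the answer register a query is diagonal: at basis state `s` it
  -- multiplies the entry by a phase, so the change is a sum over `s` of forms of single-query
  -- kernels.
  have key : (q : ℂ) * W = ∑ s : QueryBasis ι q A.workspace,
      kernelForm (fun r y => G r y * (1 - ZMod.stdAddChar (s.2.1 * (ρ r s.1 - υ y s.1))))
        (fun r => f r * answerTransform (A.state (ρ r) t) s)
        (fun y => g y * answerTransform (A.state (υ y) t) s) := by
    simp only [kernelForm, hW, ← Finset.sum_sub_distrib]
    conv_rhs => rw [Finset.sum_comm]
    rw [Finset.mul_sum]
    refine Finset.sum_congr rfl fun r _ => ?_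
    conv_rhs => rw [Finset.sum_comm]
    rw [Finset.mul_sum]
    refine Finset.sum_congr rfl fun y _ => ?_
    have h1 : (q : ℂ) * A.stateInner (ρ r) (υ y) t = _ := sum_mul_eq_sum_answerTransform _ _
    have h2 := sum_queryOracle_mul_queryOracle (ρ r) (υ y) (A.state (ρ r) t) (A.state (υ y) t)
    rw [← stateInner_succ] at h2
    calc _ = conj (f r) * G r y * g y * ((q : ℂ) * A.stateInner (ρ r) (υ y) t -
          q * A.stateInner (ρ r) (υ y) (t + 1)) := by ring
      _ = _ := by
        rw [h1, h2, ← Finset.sum_sub_distrib, Finset.mul_sum]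
        refine Finset.sum_congr rfl fun s _ => ?_
        rw [map_mul (starRingEnd ℂ)]
        ring
  have hle : q * ‖W‖ ≤ q * L := by
    calc q * ‖W‖ = ‖(q : ℂ) * W‖ := by simp
      _ ≤ _ := by rw [key]; exact norm_sum_le _ _
      _ ≤ _ := Finset.sum_le_sum fun (s : QueryBasis ι q A.workspace) _ =>
          (hL s.1 s.2.1).norm_le_weighted hL0 _ _ one_pos
      _ = q * L := by
        simp only [inv_one, one_mul]
        rw [← Finset.mul_sum, ← Finset.sum_div, Finset.sum_add_distrib,
          A.sum_norm_sq_mul_answerTransform ρ t f hf,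
          A.sum_norm_sq_mul_answerTransform υ t g hg]
        ring
  exact le_of_mul_le_mul_left hle hq0

/-- The progress after the last query of an algorithm that solves the problem. -/
theorem norm_progress_final_le (A : QuantumQueryAlgorithm ι q) (ρ : R → ι → ZMod q)
    (υ : Y → ι → ZMod q) (hρ : ∀ r, 2 / 3 ≤ A.acceptProb (ρ r))
    (hυ : ∀ y, A.acceptProb (υ y) ≤ 1 / 3) (G : R → Y → ℂ) {K : ℝ} (hK0 : 0 ≤ K)
    (hK : KernelBound G K) (f : R → ℂ) (g : Y → ℂ) (hf : ∑ r, ‖f r‖ ^ 2 = 1)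
    (hg : ∑ y, ‖g y‖ ^ 2 = 1) :
    ‖∑ r, ∑ y, conj (f r) * (G r y * A.stateInner (ρ r) (υ y) A.queries) * g y‖ ≤
      33 / 35 * K := by
  set T := A.queries with hT
  let p : QueryBasis ι q A.workspace → ℝ := fun s => ∑ r, ‖f r * A.state (ρ r) T s‖ ^ 2
  let n : QueryBasis ι q A.workspace → ℝ := fun s => ∑ y, ‖g y * A.state (υ y) T s‖ ^ 2
  have key : ∑ r, ∑ y, conj (f r) * (G r y * A.stateInner (ρ r) (υ y) T) * g y =
      ∑ s, kernelForm G (fun r => f r * A.state (ρ r) T s) (fun y => g y * A.state (υ y) T s) := by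
    simp only [kernelForm]
    conv_rhs => rw [Finset.sum_comm]
    refine Finset.sum_congr rfl fun r _ => ?_
    conv_rhs => rw [Finset.sum_comm]
    refine Finset.sum_congr rfl fun y _ => ?_
    rw [stateInner, Finset.mul_sum, Finset.mul_sum, Finset.sum_mul]
    refine Finset.sum_congr rfl fun s _ => ?_
    rw [map_mul]
    ring
  have hp : ∀ B : Finset (QueryBasis ι q A.workspace),
      ∑ s ∈ B, p s = ∑ r, ‖f r‖ ^ 2 * ∑ s ∈ B, ‖A.state (ρ r) T s‖ ^ 2 := fun B => by
    simp only [p, norm_mul, mul_pow]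
    rw [Finset.sum_comm]
    simp only [Finset.mul_sum]
  have hn : ∀ B : Finset (QueryBasis ι q A.workspace),
      ∑ s ∈ B, n s = ∑ y, ‖g y‖ ^ 2 * ∑ s ∈ B, ‖A.state (υ y) T s‖ ^ 2 := fun B => by
    simp only [n, norm_mul, mul_pow]
    rw [Finset.sum_comm]
    simp only [Finset.mul_sum]
  have hp1 : ∑ s, p s = 1 := by
    rw [hp]; simpa only [sum_norm_sq_state, mul_one] using hf
  have hn1 : ∑ s, n s = 1 := by
    rw [hn]; simpa only [sum_norm_sq_state, mul_one] using hg
  have hpa : 2 / 3 ≤ ∑ s ∈ A.accept, p s := by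
    rw [hp]
    calc (2 / 3 : ℝ) = ∑ r, ‖f r‖ ^ 2 * (2 / 3) := by rw [← Finset.sum_mul, hf, one_mul]
      _ ≤ _ := Finset.sum_le_sum fun r _ => mul_le_mul_of_nonneg_left (hρ r) (by positivity)
  have hna : ∑ s ∈ A.accept, n s ≤ 1 / 3 := by
    rw [hn]
    calc _ ≤ ∑ y, ‖g y‖ ^ 2 * (1 / 3) :=
          Finset.sum_le_sum fun y _ => mul_le_mul_of_nonneg_left (hυ y) (by positivity)
      _ = 1 / 3 := by rw [← Finset.sum_mul, hg, one_mul]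
  rw [← Finset.sum_add_sum_compl A.accept p] at hp1
  rw [← Finset.sum_add_sum_compl A.accept n] at hn1
  -- Weights near `√2`, favouring `p` or `n` according to the outcome. The two bounds add up to `K *
  -- (74 / 35 - 24 / 35 * (P - Q)) / 2`, where `P ≥ 2 / 3` and `Q ≤ 1 / 3` are the two acceptance
  -- masses; hence `33 / 35`.
  have h1 : ‖∑ s ∈ A.accept, kernelForm G (fun r => f r * A.state (ρ r) T s)
      (fun y => g y * A.state (υ y) T s)‖ ≤
      K * (((7 / 5 : ℝ)⁻¹ * ∑ s ∈ A.accept, p s + 7 / 5 * ∑ s ∈ A.accept, n s) / 2) := by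
    refine (norm_sum_le _ _).trans ((Finset.sum_le_sum fun s _ =>
      hK.norm_le_weighted hK0 _ _ (show (0 : ℝ) < 7 / 5 by norm_num)).trans_eq ?_)
    rw [← Finset.mul_sum, ← Finset.sum_div, Finset.sum_add_distrib, ← Finset.mul_sum,
      ← Finset.mul_sum]
  have h2 : ‖∑ s ∈ A.acceptᶜ, kernelForm G (fun r => f r * A.state (ρ r) T s)
      (fun y => g y * A.state (υ y) T s)‖ ≤
      K * (((5 / 7 : ℝ)⁻¹ * ∑ s ∈ A.acceptᶜ, p s + 5 / 7 * ∑ s ∈ A.acceptᶜ, n s) / 2) := by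
    refine (norm_sum_le _ _).trans ((Finset.sum_le_sum fun s _ =>
      hK.norm_le_weighted hK0 _ _ (show (0 : ℝ) < 5 / 7 by norm_num)).trans_eq ?_)
    rw [← Finset.mul_sum, ← Finset.sum_div, Finset.sum_add_distrib, ← Finset.mul_sum,
      ← Finset.mul_sum]
  rw [key, ← Finset.sum_add_sum_compl A.accept]
  refine ((norm_add_le _ _).trans (add_le_add h1 h2)).trans ?_
  rw [← mul_add, mul_comm (33 / 35 : ℝ)]
  refine mul_le_mul_of_nonneg_left ?_ hK0
  norm_num
  linarith

/-- The negative-weight adversary bound for bounded-error quantum query algorithms. -/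
theorem le_queries_of_kernelBound (A : QuantumQueryAlgorithm ι q) (ρ : R → ι → ZMod q)
    (υ : Y → ι → ZMod q) (hρ : ∀ r, 2 / 3 ≤ A.acceptProb (ρ r))
    (hυ : ∀ y, A.acceptProb (υ y) ≤ 1 / 3) (G : R → Y → ℂ) {C K L : ℝ}
    (hC : KernelBound G C) (hK : 0 < K) (hL0 : 0 ≤ L)
    (hL : ∀ (i : ι) (k : ZMod q),
      KernelBound (fun r y => G r y * (1 - ZMod.stdAddChar (k * (ρ r i - υ y i)))) L)
    (f : R → ℂ) (g : Y → ℂ) (hf : ∑ r, ‖f r‖ ^ 2 = 1) (hg : ∑ y, ‖g y‖ ^ 2 = 1)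
    (hfg : K ≤ ‖kernelForm G f g‖) :
    K ≤ 35 * (L * A.queries) := by
  -- The final progress is bounded through the full norm of `G`, so the initial progress must nearly
  -- attain that norm. The gap `34 / 35 - 33 / 35` gives the factor `35`.
  obtain ⟨K', hKK', hK', f', g', hf', hg', hfg'⟩ :=
    exists_kernelBound_near_extremal G (θ := 34 / 35) hC (by norm_num) hK hf hg hfg
  let W : ℕ → ℂ := fun t =>
    ∑ r, ∑ y, conj (f' r) * (G r y * A.stateInner (ρ r) (υ y) t) * g' y
  have h0 : W 0 = kernelForm G f' g' := by
    simp only [W, stateInner_zero, mul_one, kernelForm]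
  have hstep : ∀ t, ‖W 0 - W t‖ ≤ L * t := by
    intro t
    induction t with
    | zero => simp
    | succ t ih =>
      have h := A.norm_progress_sub_le ρ υ G hL0 hL f' g' hf' hg' t
      calc ‖W 0 - W (t + 1)‖ = ‖(W 0 - W t) + (W t - W (t + 1))‖ := by congr 1; ring
        _ ≤ L * t + L := (norm_add_le _ _).trans (add_le_add ih h)
        _ = _ := by push_cast; ring
  have hfin : ‖W A.queries‖ ≤ 33 / 35 * K' :=
    A.norm_progress_final_le ρ υ hρ hυ G (hK.le.trans hKK') hK' f' g' hf' hg'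
  have h1 : ‖W 0‖ ≤ ‖W 0 - W A.queries‖ + ‖W A.queries‖ := by
    simpa using norm_add_le (W 0 - W A.queries) (W A.queries)
  have h2 := hstep A.queries
  rw [← h0] at hfg'
  linarith

end Adversary

end QuantumQueryAlgorithm

/-! ### Block-diagonal kernels and Bessel's inequality. -/

/-- Bessel's inequality for the functions `φ κ`, `κ ∈ S`, on a finite type. -/
def BesselOn {K Z : Type*} [Fintype Z] (S : Finset K) (φ : K → Z → ℂ) : Prop :=
  ∀ f : Z → ℂ, ∑ κ ∈ S, ‖∑ z, conj (f z) * φ κ z‖ ^ 2 ≤ ∑ z, ‖f z‖ ^ 2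

theorem besselOn_of_orthonormal {K Z : Type*} [Fintype Z] [DecidableEq K] (S : Finset K)
    (φ : K → Z → ℂ)
    (h : ∀ κ ∈ S, ∀ κ' ∈ S, ∑ z, conj (φ κ z) * φ κ' z = if κ = κ' then 1 else 0) :
    BesselOn S φ := by
  intro f
  let v : S → EuclideanSpace ℂ Z := fun κ => WithLp.toLp 2 (φ κ)
  have hin : ∀ a b : Z → ℂ, inner ℂ (WithLp.toLp 2 a : EuclideanSpace ℂ Z) (WithLp.toLp 2 b) =
      ∑ z, conj (a z) * b z := fun a b => by
    simp [PiLp.inner_apply, mul_comm]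
  have hv : Orthonormal ℂ v := by
    rw [orthonormal_iff_ite]
    intro κ κ'
    simp only [v, hin, h κ.1 κ.2 κ'.1 κ'.2, Subtype.ext_iff]
  have hb := hv.sum_inner_products_le (s := Finset.univ) (WithLp.toLp 2 f)
  rw [EuclideanSpace.norm_sq_eq] at hb
  rw [← Finset.sum_coe_sort S]
  refine le_trans (le_of_eq (Finset.sum_congr rfl fun κ _ => ?_)) hb
  rw [norm_inner_symm, hin]

/-- A kernel made of blocks, each of them diagonal with respect to systems of functions that
satisfy Bessel's inequality. -/
theorem kernelBound_block {M K Y : Type*} {Z : M → Type*} [Fintype M] [Fintype K] [Fintype Y]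
    [∀ m, Fintype (Z m)] (φ : ∀ m, K → Z m → ℂ) (χ : K → Y → ℂ) (a : M → K → ℝ)
    (S : M → Finset K) (hS : ∀ m κ, a m κ ≠ 0 → κ ∈ S m) (hφ : ∀ m, BesselOn (S m) (φ m))
    (hχ : BesselOn Finset.univ χ) {C : ℝ} (hC0 : 0 ≤ C) (hC : ∀ κ, ∑ m, a m κ ^ 2 ≤ C ^ 2) :
    KernelBound (R := Σ m, Z m)
      (fun r y => ∑ κ, (a r.1 κ : ℂ) * (φ r.1 κ r.2 * conj (χ κ y))) C := by
  intro f g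
  let F : M → K → ℂ := fun m κ => ∑ z, conj (f ⟨m, z⟩) * φ m κ z
  let E : K → ℂ := fun κ => ∑ y, conj (g y) * χ κ y
  have key : kernelForm (R := Σ m, Z m)
      (fun r y => ∑ κ, (a r.1 κ : ℂ) * (φ r.1 κ r.2 * conj (χ κ y))) f g =
      ∑ p ∈ Finset.univ.sigma S, F p.1 p.2 * ((a p.1 p.2 : ℂ) * conj (E p.2)) := by
    -- Bessel's inequality for `φ m` is available only on `S m`, so the sum is restricted to where
    -- `a m` can be nonzero.
    have h1 : ∀ m, ∑ κ ∈ S m, F m κ * ((a m κ : ℂ) * conj (E κ)) =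
        ∑ κ, F m κ * ((a m κ : ℂ) * conj (E κ)) := fun m => by
      refine Finset.sum_subset (Finset.subset_univ _) fun κ _ hκ => ?_
      rw [show a m κ = 0 by by_contra h; exact hκ (hS m κ h)]
      simp
    rw [Finset.sum_sigma, Finset.sum_congr rfl fun m _ => h1 m, kernelForm, Fintype.sum_sigma]
    refine Finset.sum_congr rfl fun m _ => ?_
    have h2 : ∀ κ, F m κ * ((a m κ : ℂ) * conj (E κ)) = ∑ z, ∑ y,
        conj (f ⟨m, z⟩) * ((a m κ : ℂ) * (φ m κ z * conj (χ κ y))) * g y := fun κ => by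
      simp only [F, E, map_sum, map_mul, Complex.conj_conj]
      rw [Finset.sum_mul]
      refine Finset.sum_congr rfl fun z _ => ?_
      rw [Finset.mul_sum, Finset.mul_sum]
      refine Finset.sum_congr rfl fun y _ => ?_
      ring
    rw [Finset.sum_congr rfl fun κ _ => h2 κ]
    conv_rhs => rw [Finset.sum_comm]
    refine Finset.sum_congr rfl fun z _ => ?_
    conv_rhs => rw [Finset.sum_comm]
    refine Finset.sum_congr rfl fun y _ => ?_
    rw [Finset.mul_sum, Finset.sum_mul]
  rw [key]
  have hF : ∑ p ∈ Finset.univ.sigma S, ‖F p.1 p.2‖ ^ 2 ≤ ∑ r, ‖f r‖ ^ 2 := by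
    rw [Finset.sum_sigma, Fintype.sum_sigma]
    exact Finset.sum_le_sum fun m _ => hφ m fun z => f ⟨m, z⟩
  have hE : ∑ p ∈ Finset.univ.sigma S, ‖(a p.1 p.2 : ℂ) * conj (E p.2)‖ ^ 2 ≤
      C ^ 2 * ∑ y, ‖g y‖ ^ 2 := by
    calc _ ≤ ∑ m, ∑ κ, a m κ ^ 2 * ‖E κ‖ ^ 2 := by
          rw [Finset.sum_sigma]
          refine Finset.sum_le_sum fun m _ => ?_
          refine (Finset.sum_le_sum_of_subset_of_nonneg (Finset.subset_univ _)
            fun _ _ _ => by positivity).trans_eq ?_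
          refine Finset.sum_congr rfl fun κ _ => ?_
          simp [mul_pow]
      _ = ∑ κ, (∑ m, a m κ ^ 2) * ‖E κ‖ ^ 2 := by
          rw [Finset.sum_comm]
          simp only [Finset.sum_mul]
      _ ≤ ∑ κ, C ^ 2 * ‖E κ‖ ^ 2 :=
          Finset.sum_le_sum fun κ _ => mul_le_mul_of_nonneg_right (hC κ) (by positivity)
      _ ≤ _ := by
          rw [← Finset.mul_sum]
          exact mul_le_mul_of_nonneg_left (hχ g) (by positivity)
  calc _ ≤ ∑ p ∈ Finset.univ.sigma S, ‖F p.1 p.2‖ * ‖(a p.1 p.2 : ℂ) * conj (E p.2)‖ :=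
        (norm_sum_le _ _).trans_eq (Finset.sum_congr rfl fun p _ => norm_mul _ _)
    _ ≤ √(∑ p ∈ Finset.univ.sigma S, ‖F p.1 p.2‖ ^ 2) *
        √(∑ p ∈ Finset.univ.sigma S, ‖(a p.1 p.2 : ℂ) * conj (E p.2)‖ ^ 2) :=
        Real.sum_mul_le_sqrt_mul_sqrt _ _ _
    _ ≤ √(∑ r, ‖f r‖ ^ 2) * √(C ^ 2 * ∑ y, ‖g y‖ ^ 2) := by gcongr
    _ = _ := by
        rw [Real.sqrt_mul (by positivity), Real.sqrt_sq hC0]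
        ring

/-! ### Characters restricted to subgroups. -/

section Characters

variable {ι : Type*} [Fintype ι] {q : ℕ} [NeZero q]

/-- The characters `S` are pairwise distinct on the subgroup `H`. -/
def DistinctOn (H : AddSubgroup (ι → ZMod q)) (S : Set (ι → ZMod q)) : Prop :=
  ∀ κ ∈ S, ∀ κ' ∈ S, (∀ x ∈ H, (κ - κ') ⬝ᵥ x = 0) → κ = κ'

/-- The character with index `κ`, normalized on the subgroup `H`. -/
noncomputable def normalizedChar (H : AddSubgroup (ι → ZMod q)) [Fintype H] (κ : ι → ZMod q)
    (x : H) : ℂ :=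
  ((√(Fintype.card H))⁻¹ : ℝ) * ZMod.stdAddChar (κ ⬝ᵥ x.1)

theorem normalizedChar_add (H : AddSubgroup (ι → ZMod q)) [Fintype H] (κ κ' : ι → ZMod q)
    (x : H) : normalizedChar H (κ + κ') x =
      normalizedChar H κ x * ZMod.stdAddChar (κ' ⬝ᵥ x.1) := by
  rw [normalizedChar, normalizedChar, add_dotProduct, AddChar.map_add_eq_mul, mul_assoc]

theorem sum_stdAddChar_dotProduct_eq_zero (H : AddSubgroup (ι → ZMod q)) [Fintype H]
    (κ : ι → ZMod q) (h : ∃ x ∈ H, κ ⬝ᵥ x ≠ 0) :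
    ∑ x : H, ZMod.stdAddChar (κ ⬝ᵥ x.1) = 0 := by
  obtain ⟨x, hx, hκ⟩ := h
  let F : H →+ ZMod q := AddMonoidHom.mk' (fun x => κ ⬝ᵥ x.1) fun a b => by simp [dotProduct_add]
  have hF : ∀ x, (ZMod.stdAddChar (N := q)).compAddMonoidHom F x =
      ZMod.stdAddChar (κ ⬝ᵥ x.1) := fun x => rfl
  have h2 : (ZMod.stdAddChar (N := q)).compAddMonoidHom F ≠ 1 := by
    intro h1
    have h3 := hF ⟨x, hx⟩
    rw [h1, AddChar.one_apply, ← AddChar.map_zero_eq_one (ZMod.stdAddChar (N := q))] at h3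
    exact hκ (ZMod.injective_stdAddChar h3).symm
  have h4 := AddChar.sum_eq_zero_of_ne_one h2
  simpa only [hF] using h4

/-- The quotient of two characters that differ on `H` is nontrivial there, so it sums to zero and
the characters are orthonormal. -/
theorem DistinctOn.besselOn_normalizedChar {H : AddSubgroup (ι → ZMod q)} [Fintype H]
    {S : Finset (ι → ZMod q)} (hS : DistinctOn H (S : Set (ι → ZMod q))) :
    BesselOn S (normalizedChar H) := by
  classical
  refine besselOn_of_orthonormal S _ fun κ hκ κ' hκ' => ?_
  have hN : (0 : ℝ) < Fintype.card H := Nat.cast_pos.2 Fintype.card_pos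
  have h1 : ∑ x : H, conj (normalizedChar H κ x) * normalizedChar H κ' x =
      ((Fintype.card H : ℝ)⁻¹ : ℝ) * ∑ x : H, ZMod.stdAddChar ((κ' - κ) ⬝ᵥ x.1) := by
    rw [Finset.mul_sum]
    refine Finset.sum_congr rfl fun x _ => ?_
    have hc : (((√(Fintype.card H))⁻¹ : ℝ) : ℂ) * ((√(Fintype.card H))⁻¹ : ℝ) =
        ((Fintype.card H : ℝ)⁻¹ : ℝ) := by
      rw [← Complex.ofReal_mul, ← mul_inv, Real.mul_self_sqrt hN.le]
    rw [normalizedChar, normalizedChar, map_mul (starRingEnd ℂ), Complex.conj_ofReal,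
      ← AddChar.map_neg_eq_conj, sub_dotProduct, sub_eq_add_neg, AddChar.map_add_eq_mul, ← hc]
    ring
  rw [h1]
  split_ifs with h
  · subst h
    have : (Fintype.card H : ℂ) ≠ 0 := by exact_mod_cast hN.ne'
    simp [this]
  · rw [sum_stdAddChar_dotProduct_eq_zero, mul_zero]
    by_contra! h0
    exact h (hS κ' hκ' κ hκ h0).symm

theorem besselOn_univ_normalizedChar_top [DecidableEq ι] [Fintype (⊤ : AddSubgroup (ι → ZMod q))] :
    BesselOn Finset.univ (normalizedChar (⊤ : AddSubgroup (ι → ZMod q))) := by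
  classical
  refine DistinctOn.besselOn_normalizedChar fun κ _ κ' _ h => ?_
  rw [← sub_eq_zero]
  funext i
  simpa using h (Pi.single i 1) trivial

end Characters

/-! ### Kernels diagonal in characters, and the effect of a query on them. -/

section CharKernel

variable {ι : Type*} [Fintype ι] [DecidableEq ι] {q : ℕ} [NeZero q] {M : Type*}
  [Fintype (⊤ : AddSubgroup (ι → ZMod q))]

/-- The kernel that, from all inputs to the inputs in `H m`, multiplies the character `κ` by the
coefficient `a m κ` and restricts it to `H m`. -/
noncomputable def charKernel (H : M → AddSubgroup (ι → ZMod q)) [∀ m, Fintype (H m)]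
    (a : M → (ι → ZMod q) → ℝ) (r : Σ m, H m) (y : (⊤ : AddSubgroup (ι → ZMod q))) : ℂ :=
  ∑ κ, (a r.1 κ : ℂ) * (normalizedChar (H r.1) κ r.2 * conj (normalizedChar ⊤ κ y))

theorem kernelBound_charKernel [Fintype M] (H : M → AddSubgroup (ι → ZMod q))
    [∀ m, Fintype (H m)]
    (a : M → (ι → ZMod q) → ℝ) {S : M → Set (ι → ZMod q)} (hS : ∀ m κ, κ ∉ S m → a m κ = 0)
    (hd : ∀ m, DistinctOn (H m) (S m)) {C : ℝ} (hC0 : 0 ≤ C)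
    (hC : ∀ κ, ∑ m, a m κ ^ 2 ≤ C ^ 2) : KernelBound (charKernel H a) C := by
  classical
  refine kernelBound_block (fun m => normalizedChar (H m)) (normalizedChar ⊤) a
    (fun m => (S m).toFinset) (fun m κ h => ?_) (fun m => ?_)
    besselOn_univ_normalizedChar_top hC0 hC
  · by_contra h'
    exact h (hS m κ (by simpa using h'))
  · exact DistinctOn.besselOn_normalizedChar (by simpa using hd m)

/-- A query changes the coefficients of a `charKernel` by a translation. -/
theorem charKernel_mul_one_sub (H : M → AddSubgroup (ι → ZMod q)) [∀ m, Fintype (H m)]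
    (a : M → (ι → ZMod q) → ℝ) (i : ι) (k : ZMod q) (r : Σ m, H m)
    (y : (⊤ : AddSubgroup (ι → ZMod q))) :
    charKernel H a r y * (1 - ZMod.stdAddChar (k * (r.2.1 i - y.1 i))) =
      charKernel H (fun m κ => a m κ - a m (κ - Pi.single i k)) r y := by
  have h : charKernel H a r y * ZMod.stdAddChar (k * (r.2.1 i - y.1 i)) =
      charKernel H (fun m κ => a m (κ - Pi.single i k)) r y := by
    rw [charKernel, charKernel, Finset.sum_mul]
    conv_rhs => rw [← Equiv.sum_comp (Equiv.addRight (Pi.single i k : ι → ZMod q))]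
    refine Finset.sum_congr rfl fun κ _ => ?_
    simp only [Equiv.coe_addRight, add_sub_cancel_right]
    rw [normalizedChar_add, normalizedChar_add,
      map_mul (starRingEnd ℂ), ← AddChar.map_neg_eq_conj, single_dotProduct, single_dotProduct,
      mul_sub, sub_eq_add_neg, AddChar.map_add_eq_mul]
    ring
  rw [mul_sub, mul_one, h]
  simp only [charKernel, ← Finset.sum_sub_distrib]
  refine Finset.sum_congr rfl fun κ _ => ?_
  push_cast
  ring

/-- The difference lives on `S m` together with its translate by the queried character. Their union
need not be distinct on `H m`, but each of the two sets is; splitting along `S m` costs the factor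
two in `C + C`. -/
theorem kernelBound_charKernel_mul_one_sub [Fintype M] (H : M → AddSubgroup (ι → ZMod q))
    [∀ m, Fintype (H m)] (a : M → (ι → ZMod q) → ℝ) {S : M → Set (ι → ZMod q)}
    (hS : ∀ m κ, κ ∉ S m → a m κ = 0) (hd : ∀ m, DistinctOn (H m) (S m)) (i : ι) (k : ZMod q)
    {C : ℝ} (hC0 : 0 ≤ C)
    (hC : ∀ κ, ∑ m, (a m κ - a m (κ - Pi.single i k)) ^ 2 ≤ C ^ 2) :
    KernelBound (fun r y => charKernel H a r y *
      (1 - ZMod.stdAddChar (k * (r.2.1 i - y.1 i)))) (C + C) := by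
  classical
  let d : M → (ι → ZMod q) → ℝ := fun m κ => a m κ - a m (κ - Pi.single i k)
  let d₁ : M → (ι → ZMod q) → ℝ := fun m κ => if κ ∈ S m then d m κ else 0
  let d₂ : M → (ι → ZMod q) → ℝ := fun m κ => if κ ∈ S m then 0 else d m κ
  have hsplit : (fun r y => charKernel H a r y *
      (1 - ZMod.stdAddChar (k * (r.2.1 i - y.1 i)))) =
      fun r y => charKernel H d₁ r y + charKernel H d₂ r y := by
    funext r y
    rw [charKernel_mul_one_sub]
    simp only [charKernel, ← Finset.sum_add_distrib]
    refine Finset.sum_congr rfl fun κ _ => ?_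
    rw [← add_mul, ← Complex.ofReal_add]
    congr 2
    simp only [d₁, d₂, d]
    split_ifs <;> simp
  rw [hsplit]
  refine KernelBound.add ?_ ?_
  · refine kernelBound_charKernel H d₁ (S := S) (fun m κ h => if_neg h) hd hC0 fun κ => ?_
    refine (Finset.sum_le_sum fun m _ => ?_).trans (hC κ)
    simp only [d₁, d]
    split_ifs
    · exact le_rfl
    · simpa using sq_nonneg _
  · refine kernelBound_charKernel H d₂ (S := fun m => {κ | κ - Pi.single i k ∈ S m})
      (fun m κ h => ?_) (fun m κ hκ κ' hκ' h => ?_) hC0 fun κ => ?_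
    · simp only [d₂, d]
      split_ifs with h'
      · rfl
      · rw [hS m κ h', hS m _ h, sub_zero]
    · have := hd m _ hκ _ hκ' (by simpa using h)
      simpa using this
    · refine (Finset.sum_le_sum fun m _ => ?_).trans (hC κ)
      simp only [d₂, d]
      split_ifs
      · simpa using sq_nonneg _
      · exact le_rfl

/-- The sum of a row block of a `charKernel`. -/
theorem sum_charKernel (H : M → AddSubgroup (ι → ZMod q)) [∀ m, Fintype (H m)]
    (a : M → (ι → ZMod q) → ℝ) {S : M → Set (ι → ZMod q)} (hS : ∀ m κ, κ ∉ S m → a m κ = 0)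
    (hd : ∀ m, DistinctOn (H m) (S m)) (h0 : ∀ m, 0 ∈ S m) (m : M)
    (y : (⊤ : AddSubgroup (ι → ZMod q))) :
    ∑ x : H m, charKernel H a ⟨m, x⟩ y =
      ((a m 0 * √(Fintype.card (H m)) * (√(Fintype.card (ι → ZMod q)))⁻¹ : ℝ) : ℂ) := by
  simp only [charKernel]
  rw [Finset.sum_comm, Finset.sum_eq_single 0]
  · have hN : (0 : ℝ) < Fintype.card (H m) := Nat.cast_pos.2 Fintype.card_pos
    have hs : (Fintype.card (H m) : ℝ) * (√(Fintype.card (H m)))⁻¹ = √(Fintype.card (H m)) := by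
      rw [← div_eq_mul_inv, Real.div_sqrt]
    have hc : Fintype.card (⊤ : AddSubgroup (ι → ZMod q)) = Fintype.card (ι → ZMod q) :=
      Fintype.card_congr AddSubgroup.topEquiv.toEquiv
    simp only [normalizedChar, zero_dotProduct, AddChar.map_zero_eq_one, mul_one,
      Complex.conj_ofReal, hc]
    rw [Finset.sum_const, Finset.card_univ, nsmul_eq_mul]
    conv_rhs => rw [← hs]
    push_cast
    ring
  · intro κ _ hκ
    by_cases hκS : κ ∈ S m
    · rw [← Finset.mul_sum, ← Finset.sum_mul]
      simp only [normalizedChar]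
      -- As `0 ∈ S m`, distinctness makes every other character of `S m` nontrivial on `H m`, so
      -- only `κ = 0` survives the summation.
      rw [← Finset.mul_sum, sum_stdAddChar_dotProduct_eq_zero]
      · simp
      · by_contra! h
        exact hκ (hd m κ hκS 0 (h0 m) (by simpa using h))
    · simp [hS m κ hκS]
  · simp

/-- The squared norm of a vector that is constant on blocks. -/
theorem sum_sigma_norm_ofReal_sq [Fintype M] {Z : M → Type*} [∀ m, Fintype (Z m)] (w : M → ℝ) :
    ∑ r : Σ m, Z m, ‖(w r.1 : ℂ)‖ ^ 2 = ∑ m, (Fintype.card (Z m) : ℝ) * w m ^ 2 := by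
  rw [Fintype.sum_sigma]
  refine Finset.sum_congr rfl fun m _ => ?_
  calc _ = ∑ _x : Z m, w m ^ 2 := Finset.sum_congr rfl fun x _ => by
        rw [Complex.norm_real, Real.norm_eq_abs, sq_abs]
    _ = _ := by rw [Finset.sum_const, Finset.card_univ, nsmul_eq_mul]

/-- The value of a `charKernel` on vectors that are constant on blocks. -/
theorem kernelForm_charKernel_const [Fintype M] (H : M → AddSubgroup (ι → ZMod q))
    [∀ m, Fintype (H m)] (a : M → (ι → ZMod q) → ℝ) {S : M → Set (ι → ZMod q)}
    (hS : ∀ m κ, κ ∉ S m → a m κ = 0) (hd : ∀ m, DistinctOn (H m) (S m)) (h0 : ∀ m, 0 ∈ S m)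
    {Y : Type*} [Fintype Y] (v : Y → (⊤ : AddSubgroup (ι → ZMod q))) (w : M → ℝ) (b : ℝ) :
    kernelForm (fun r y => charKernel H a r (v y)) (fun r => (w r.1 : ℂ)) (fun _ => (b : ℂ)) =
      (((∑ m, w m * (a m 0 * √(Fintype.card (H m)) * (√(Fintype.card (ι → ZMod q)))⁻¹)) *
        (Fintype.card Y * b) : ℝ) : ℂ) := by
  rw [kernelForm, Fintype.sum_sigma, Finset.sum_mul, Complex.ofReal_sum]
  refine Finset.sum_congr rfl fun m _ => ?_
  rw [Finset.sum_comm]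
  calc _ = ∑ y, (w m : ℂ) * (∑ x : H m, charKernel H a ⟨m, x⟩ (v y)) * b := by
        refine Finset.sum_congr rfl fun y _ => ?_
        rw [Finset.mul_sum, Finset.sum_mul]
        refine Finset.sum_congr rfl fun x _ => ?_
        rw [Complex.conj_ofReal]
    _ = _ := by
        simp only [sum_charKernel H a hS hd h0]
        rw [Finset.sum_const, Finset.card_univ, nsmul_eq_mul]
        push_cast
        ring

end CharKernel

/-! ### The shift subgroups, sparse characters and adversary coefficients. -/

section ShiftSum

variable {n q : ℕ} [NeZero n]

/-- The circular shifts of the three rows. -/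
def rowShift (m : Fin n × Fin n) : Fin 3 → Fin n := ![0, m.1, m.2]

/-- Two cells in different rows that the shift `m` brings into the same column. -/
def Aligned (m : Fin n × Fin n) (p p' : Fin 3 × Fin n) : Prop :=
  p.1 ≠ p'.1 ∧ p.2 - rowShift m p.1 = p'.2 - rowShift m p'.1

/-- The tables whose columns sum to zero after the shift `m`. -/
def shiftSumSubgroup (q : ℕ) (m : Fin n × Fin n) : AddSubgroup (Fin 3 × Fin n → ZMod q) where
  carrier := {x | ∀ i, ∑ r, x (r, i + rowShift m r) = 0}
  zero_mem' := by simp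
  add_mem' := fun {x y} hx hy i => by
    simp only [Pi.add_apply, Finset.sum_add_distrib]
    rw [hx i, hy i, add_zero]
  neg_mem' := fun {x} hx i => by
    simp only [Pi.neg_apply, Finset.sum_neg_distrib]
    rw [hx i, neg_zero]

theorem shiftSumSubgroup_subset_pos (m : Fin n × Fin n) {x : Fin 3 × Fin n → ZMod q}
    (hx : x ∈ shiftSumSubgroup q m) : x ∈ threeShiftSumPos n q := by
  refine ⟨m.1, m.2, fun i => ?_⟩
  have h : ∑ r, x (r, i + rowShift m r) = 0 := hx i
  simpa [Fin.sum_univ_three, rowShift] using h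

/-- The characters whose support contains at most one cell of each column shifted by `m`. -/
def sparseChars (q : ℕ) (m : Fin n × Fin n) : Set (Fin 3 × Fin n → ZMod q) :=
  {κ | ∀ p p', Aligned m p p' → κ p = 0 ∨ κ p' = 0}

/-- Test `d` on the table with `1` at `p` and `-1` at `p'`, which lies in the subgroup because both
cells are in the same shifted column. -/
theorem eq_of_aligned {m : Fin n × Fin n} {p p' : Fin 3 × Fin n} (h : Aligned m p p')
    {d : Fin 3 × Fin n → ZMod q} (hd : ∀ x ∈ shiftSumSubgroup q m, d ⬝ᵥ x = 0) : d p = d p' := by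
  have hs : ∀ (p : Fin 3 × Fin n) (i : Fin n),
      ∑ r, (Pi.single p 1 : Fin 3 × Fin n → ZMod q) (r, i + rowShift m r) =
        if i = p.2 - rowShift m p.1 then 1 else 0 := by
    rintro ⟨r₀, u⟩ i
    rw [Finset.sum_eq_single r₀]
    · simp [Pi.single_apply, eq_sub_iff_add_eq]
    · intro r _ hr
      simp [hr]
    · simp
  have hx : (Pi.single p 1 - Pi.single p' 1 : Fin 3 × Fin n → ZMod q) ∈ shiftSumSubgroup q m := by
    intro i
    simp only [Pi.sub_apply, Finset.sum_sub_distrib]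
    rw [hs, hs, h.2, sub_self]
  simpa [dotProduct_sub, sub_eq_zero] using hd _ hx

/-- A difference trivial on the subgroup is constant on each shifted column. If that constant is
nonzero, each of the three cells lies in the support of `κ` or `κ'`, yet each support has at most
one cell in the column. -/
theorem distinctOn_sparseChars (m : Fin n × Fin n) :
    DistinctOn (shiftSumSubgroup q m) (sparseChars q m) := by
  intro κ hκ κ' hκ' h
  rw [← sub_eq_zero]
  funext p
  by_contra hp
  let P : Fin 3 → Fin 3 × Fin n := fun r => (r, p.2 - rowShift m p.1 + rowShift m r)
  have hP : ∀ r r', r ≠ r' → Aligned m (P r) (P r') := fun r r' hr => ⟨hr, by simp [P]⟩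
  have hne : ∀ r, κ (P r) ≠ 0 ∨ κ' (P r) ≠ 0 := by
    intro r
    have h1 : (κ - κ') (P r) = (κ - κ') p := by
      by_cases hr : r = p.1
      · subst hr
        simp [P]
      · exact eq_of_aligned ⟨hr, by simp [P]⟩ h
    by_contra! h2
    apply hp
    rw [← h1, Pi.sub_apply, h2.1, h2.2, sub_zero]
    rfl
  have h0 := hne 0
  have h1 := hne 1
  have h2 := hne 2
  have a01 := hκ _ _ (hP 0 1 (by decide))
  have a02 := hκ _ _ (hP 0 2 (by decide))
  have a12 := hκ _ _ (hP 1 2 (by decide))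
  have b01 := hκ' _ _ (hP 0 1 (by decide))
  have b02 := hκ' _ _ (hP 0 2 (by decide))
  have b12 := hκ' _ _ (hP 1 2 (by decide))
  tauto

-- Alignment of two cells in different rows is one equation on the shift `(b, c)`: it determines `c`
-- from `b` if row `2` is involved, and determines `b` otherwise.
open Classical in
theorem card_aligned_le (p p' : Fin 3 × Fin n) :
    (Finset.univ.filter fun m : Fin n × Fin n => Aligned m p p').card ≤ n := by
  obtain ⟨r, u⟩ := p
  obtain ⟨r', u'⟩ := p'
  have key : ∀ π : Fin n × Fin n → Fin n,
      (∀ m m', Aligned m (r, u) (r', u') → Aligned m' (r, u) (r', u') → π m = π m' → m = m') →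
      (Finset.univ.filter fun m : Fin n × Fin n => Aligned m (r, u) (r', u')).card ≤ n := by
    intro π hπ
    calc _ ≤ (Finset.univ : Finset (Fin n)).card :=
          Finset.card_le_card_of_injOn π (fun _ _ => Finset.mem_coe.2 (Finset.mem_univ _))
            fun m hm m' hm' h => hπ m m' (by simpa using hm) (by simpa using hm') h
      _ = n := by simp
  by_cases h2 : r = 2 ∨ r' = 2
  · refine key Prod.fst ?_
    rintro ⟨b, c⟩ ⟨b', c'⟩ ⟨h, e⟩ ⟨_, e'⟩ (rfl : b = b')
    clear key
    fin_cases r <;> fin_cases r' <;> simp_all [rowShift] <;>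
      exact sub_right_inj.1 (e.trans e'.symm)
  · refine key Prod.snd ?_
    rintro ⟨b, c⟩ ⟨b', c'⟩ ⟨h, e⟩ ⟨_, e'⟩ (rfl : c = c')
    clear key
    fin_cases r <;> fin_cases r' <;> simp_all [rowShift]
    exact sub_right_inj.1 (e.trans e'.symm)

open Classical in
/-- The coefficients of the adversary kernel. -/
noncomputable def adversaryCoeff (n q R : ℕ) [NeZero n] (m : Fin n × Fin n)
    (κ : Fin 3 × Fin n → ZMod q) : ℝ :=
  if κ ∈ sparseChars q m then ((R - (Finset.univ.filter fun p => κ p ≠ 0).card : ℕ) : ℝ) / n else 0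

theorem Aligned.symm {m : Fin n × Fin n} {p p' : Fin 3 × Fin n} (h : Aligned m p p') :
    Aligned m p' p :=
  ⟨h.1.symm, h.2.symm⟩

-- If both characters are sparse, their support sizes differ by at most one, giving `1 / n ^ 2`. If
-- only one is, the violating pair contains `j`, so `j` is aligned with a support cell, whose term
-- alone dominates.
open Classical in
theorem adversaryCoeff_sub_sq_le (R : ℕ) {κ κ' : Fin 3 × Fin n → ZMod q} {j : Fin 3 × Fin n}
    (h : ∀ p, p ≠ j → κ p = κ' p) (m : Fin n × Fin n) :
    (adversaryCoeff n q R m κ - adversaryCoeff n q R m κ') ^ 2 ≤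
      1 / (n : ℝ) ^ 2 + ∑ p with p ≠ j ∧ κ p ≠ 0,
        if Aligned m j p then (R : ℝ) ^ 2 / n ^ 2 else 0 := by
  have hn : (0 : ℝ) < n := Nat.cast_pos.2 (NeZero.pos n)
  have hnonneg : ∀ κ : Fin 3 × Fin n → ZMod q, 0 ≤ ∑ p with p ≠ j ∧ κ p ≠ 0,
      if Aligned m j p then (R : ℝ) ^ 2 / n ^ 2 else 0 := fun κ =>
    Finset.sum_nonneg fun p _ => by split_ifs <;> positivity
  have hT : ∀ {κ κ' : Fin 3 × Fin n → ZMod q}, (∀ p, p ≠ j → κ p = κ' p) →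
      (Finset.univ.filter fun p => p ≠ j ∧ κ p ≠ 0) =
        Finset.univ.filter fun p => p ≠ j ∧ κ' p ≠ 0 := fun {κ κ'} h =>
    Finset.filter_congr fun p _ => and_congr_right fun hp => by rw [h p hp]
  have hmixed : ∀ {κ κ' : Fin 3 × Fin n → ZMod q}, (∀ p, p ≠ j → κ p = κ' p) →
      κ ∈ sparseChars q m → κ' ∉ sparseChars q m →
      (((R - (Finset.univ.filter fun p => κ p ≠ 0).card : ℕ) : ℝ) / n) ^ 2 ≤
        ∑ p with p ≠ j ∧ κ p ≠ 0, if Aligned m j p then (R : ℝ) ^ 2 / n ^ 2 else 0 := by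
    intro κ κ' h hκ hκ'
    have hex : ∃ p, p ≠ j ∧ κ p ≠ 0 ∧ Aligned m j p := by
      simp only [sparseChars, Set.mem_ofPred_eq, not_forall, not_or] at hκ'
      obtain ⟨p, p', hpp, hp, hp'⟩ := hκ'
      by_cases e : p = j
      · subst e
        have e' : p' ≠ p := fun e' => hpp.1 (by rw [e'])
        exact ⟨p', e', by rwa [h p' e'], hpp⟩
      by_cases e' : p' = j
      · subst e'
        exact ⟨p, e, by rwa [h p e], hpp.symm⟩
      · rw [← h p e] at hp
        rw [← h p' e'] at hp'
        exact ((hκ p p' hpp).elim hp hp').elim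
    obtain ⟨p, hpj, hp, hal⟩ := hex
    calc _ ≤ (R : ℝ) ^ 2 / n ^ 2 := by
          rw [div_pow]
          gcongr
          exact Nat.sub_le _ _
      _ = if Aligned m j p then (R : ℝ) ^ 2 / n ^ 2 else 0 := by rw [if_pos hal]
      _ ≤ _ := Finset.single_le_sum
          (f := fun p => if Aligned m j p then (R : ℝ) ^ 2 / n ^ 2 else 0)
          (fun p _ => by split_ifs <;> positivity)
          (Finset.mem_filter.2 ⟨Finset.mem_univ _, hpj, hp⟩)
  have hcard : ∀ {κ κ' : Fin 3 × Fin n → ZMod q}, (∀ p, p ≠ j → κ p = κ' p) →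
      (Finset.univ.filter fun p => κ p ≠ 0).card ≤
        (Finset.univ.filter fun p => κ' p ≠ 0).card + 1 := by
    intro κ κ' h
    refine (Finset.card_le_card fun p hp => ?_).trans (Finset.card_insert_le j _)
    rw [Finset.mem_insert]
    by_cases e : p = j
    · exact Or.inl e
    · exact Or.inr (by simpa [← h p e] using hp)
  have h' : ∀ p, p ≠ j → κ' p = κ p := fun p hp => (h p hp).symm
  have hinv : 0 ≤ 1 / (n : ℝ) ^ 2 := by positivity
  simp only [adversaryCoeff]
  split_ifs with h1 h2 h2
  · have c1 := hcard h
    have c2 := hcard h'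
    set N := (Finset.univ.filter fun p => κ p ≠ 0).card
    set N' := (Finset.univ.filter fun p => κ' p ≠ 0).card
    have e1 : ((R - N : ℕ) : ℝ) ≤ ((R - N' : ℕ) : ℝ) + 1 := by
      exact_mod_cast (by omega : R - N ≤ R - N' + 1)
    have e2 : ((R - N' : ℕ) : ℝ) ≤ ((R - N : ℕ) : ℝ) + 1 := by
      exact_mod_cast (by omega : R - N' ≤ R - N + 1)
    refine le_add_of_le_of_nonneg ?_ (hnonneg κ)
    rw [← sub_div, div_pow]
    gcongr
    nlinarith
  · rw [sub_zero]
    exact le_add_of_nonneg_of_le hinv (hmixed h h1 h2)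
  · rw [zero_sub, neg_sq, hT h]
    exact le_add_of_nonneg_of_le hinv (hmixed h' h2 h1)
  · simpa using add_nonneg hinv (hnonneg κ)

theorem sum_adversaryCoeff_sub_sq_le {R : ℕ} (hR : R ^ 3 ≤ n) {κ κ' : Fin 3 × Fin n → ZMod q}
    {j : Fin 3 × Fin n} (h : ∀ p, p ≠ j → κ p = κ' p) :
    ∑ m, (adversaryCoeff n q R m κ - adversaryCoeff n q R m κ') ^ 2 ≤ 2 := by
  classical
  have hn : (0 : ℝ) < n := Nat.cast_pos.2 (NeZero.pos n)
  -- `T` is the common support away from `j`. If it has at least `R` cells, truncated subtraction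
  -- makes both coefficients vanish, so only fewer than `R` cells need counting.
  set T : Finset (Fin 3 × Fin n) := Finset.univ.filter fun p => p ≠ j ∧ κ p ≠ 0 with hT
  by_cases hTR : R ≤ T.card
  · have h0 : ∀ κ'' : Fin 3 × Fin n → ZMod q, (∀ p, p ≠ j → κ p = κ'' p) →
        ∀ m, adversaryCoeff n q R m κ'' = 0 := by
      intro κ'' h'' m
      have hle : T.card ≤ (Finset.univ.filter fun p => κ'' p ≠ 0).card := by
        refine Finset.card_le_card fun p hp => ?_
        rw [hT, Finset.mem_filter] at hp
        rw [Finset.mem_filter, ← h'' p hp.2.1]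
        exact ⟨hp.1, hp.2.2⟩
      rw [adversaryCoeff, Nat.sub_eq_zero_of_le (by convert hTR.trans hle)]
      simp
    simp [h0 κ fun _ _ => rfl, h0 κ' h]
  · calc _ ≤ ∑ m : Fin n × Fin n, (1 / (n : ℝ) ^ 2 + ∑ p ∈ T,
          if Aligned m j p then (R : ℝ) ^ 2 / n ^ 2 else 0) := by
          refine Finset.sum_le_sum fun m _ => ?_
          convert adversaryCoeff_sub_sq_le R h m
      _ = 1 + ∑ p ∈ T, ((Finset.univ.filter fun m : Fin n × Fin n => Aligned m j p).card : ℝ) *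
          ((R : ℝ) ^ 2 / n ^ 2) := by
          rw [Finset.sum_add_distrib, Finset.sum_comm]
          congr 1
          · simp [Finset.card_univ]
            field_simp
          · refine Finset.sum_congr rfl fun p _ => ?_
            rw [← Finset.sum_filter, Finset.sum_const, nsmul_eq_mul]
      _ ≤ 1 + ∑ p ∈ T, (n : ℝ) * ((R : ℝ) ^ 2 / n ^ 2) := by
          gcongr with p hp
          convert card_aligned_le j p
      _ ≤ 1 + R * ((n : ℝ) * ((R : ℝ) ^ 2 / n ^ 2)) := by
          rw [Finset.sum_const, nsmul_eq_mul]
          gcongr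
          exact (not_le.1 hTR).le
      _ = 1 + (R : ℝ) ^ 3 / n := by
          field_simp
      _ ≤ 1 + 1 := by
          gcongr
          rw [div_le_one hn]
          exact_mod_cast hR
      _ = 2 := by norm_num

end ShiftSum

/-! ### Negative inputs are at least half of all tables. -/

section Negative

variable {n q : ℕ}

open Classical in
theorem card_sum_three_eq_zero [NeZero q] (i j k : Fin n) :
    q * (Finset.univ.filter fun x : Fin 3 × Fin n → ZMod q =>
      x (0, i) + x (1, j) + x (2, k) = 0).card = Fintype.card (Fin 3 × Fin n → ZMod q) := by
  have h : ∀ t : ZMod q, (Finset.univ.filter fun x : Fin 3 × Fin n → ZMod q =>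
      x (0, i) + x (1, j) + x (2, k) = t).card =
      (Finset.univ.filter fun x : Fin 3 × Fin n → ZMod q =>
      x (0, i) + x (1, j) + x (2, k) = 0).card := by
    intro t
    -- Subtracting `t` in the cell `(0, i)` alone maps the fibre over `t` onto the fibre over `0`,
    -- so all `q` fibres have equal size.
    refine Finset.card_equiv (Equiv.subRight (Pi.single (0, i) t)) fun x => ?_
    simp only [Finset.mem_filter, Finset.mem_univ, true_and, Equiv.subRight_apply, Pi.sub_apply,
      Pi.single_eq_same]
    rw [Pi.single_eq_of_ne (by simp), Pi.single_eq_of_ne (by simp), ← sub_eq_zero]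
    ring_nf
  have h2 := Finset.card_eq_sum_card_fiberwise (s := Finset.univ) (t := Finset.univ)
    (f := fun x : Fin 3 × Fin n → ZMod q => x (0, i) + x (1, j) + x (2, k)) (by simp)
  rw [Finset.sum_congr rfl fun t _ => h t, Finset.sum_const, Finset.card_univ, Finset.card_univ,
    ZMod.card, smul_eq_mul] at h2
  exact h2.symm

-- Union bound: each of the `n ^ 3` triples of columns sums to zero on a fraction `1 / q` of the
-- tables, and `n ^ 3 / q ≤ 1 / 2`.
open Classical in
theorem card_le_two_mul_card_neg [NeZero q] (hq : 2 * n ^ 3 ≤ q) :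
    Fintype.card (Fin 3 × Fin n → ZMod q) ≤ 2 * Fintype.card (threeShiftSumNeg n q) := by
  set N := Fintype.card (Fin 3 × Fin n → ZMod q) with hN
  let B : Fin n × Fin n × Fin n → Finset (Fin 3 × Fin n → ZMod q) := fun p =>
    Finset.univ.filter fun x => x (0, p.1) + x (1, p.2.1) + x (2, p.2.2) = 0
  have hcover : (Finset.univ : Finset (Fin 3 × Fin n → ZMod q)) ⊆
      (threeShiftSumNeg n q).toFinset ∪ Finset.univ.biUnion B := by
    intro x _
    by_cases hx : x ∈ threeShiftSumNeg n q
    · exact Finset.mem_union_left _ (by simpa using hx)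
    · refine Finset.mem_union_right _ ?_
      simp only [threeShiftSumNeg, Set.mem_ofPred_eq, not_forall, not_not] at hx
      obtain ⟨i, j, k, h⟩ := hx
      exact Finset.mem_biUnion.2 ⟨(i, j, k), Finset.mem_univ _, by simpa [B] using h⟩
  have h1 : N ≤ Fintype.card (threeShiftSumNeg n q) + ∑ p, (B p).card := by
    rw [hN, ← Finset.card_univ, ← Set.toFinset_card]
    exact (Finset.card_le_card hcover).trans
      ((Finset.card_union_le _ _).trans (Nat.add_le_add_left Finset.card_biUnion_le _))
  have h2 : q * ∑ p, (B p).card = n ^ 3 * N := by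
    rw [Finset.mul_sum, Finset.sum_congr rfl fun p _ => card_sum_three_eq_zero p.1 p.2.1 p.2.2]
    simp only [Finset.sum_const, Finset.card_univ, Fintype.card_prod, Fintype.card_fin,
      smul_eq_mul]
    ring
  have hq0 : 0 < q := NeZero.pos q
  have h3 : 2 * ∑ p, (B p).card ≤ N := by
    refine Nat.le_of_mul_le_mul_left ?_ hq0
    calc q * (2 * ∑ p, (B p).card) = 2 * n ^ 3 * N := by rw [mul_left_comm, h2]; ring
      _ ≤ q * N := Nat.mul_le_mul_right _ hq
  omega

end Negative

/-! ### Assembling the lower bound. -/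

section Main

variable {n q : ℕ} [NeZero n]

theorem adversaryCoeff_zero (R : ℕ) (m : Fin n × Fin n) : adversaryCoeff n q R m 0 = R / n := by
  rw [adversaryCoeff, if_pos (show (0 : Fin 3 × Fin n → ZMod q) ∈ sparseChars q m from
    fun p p' _ => Or.inl rfl)]
  simp

theorem QuantumQueryAlgorithm.le_queries_of_threeShiftSum [NeZero q] (hq : 2 * n ^ 3 ≤ q) {R : ℕ}
    (hR0 : 0 < R) (hR : R ^ 3 ≤ n) (A : QuantumQueryAlgorithm (Fin 3 × Fin n) q)
    (hA : A.Solves (threeShiftSumPos n q) (threeShiftSumNeg n q)) :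
    (R : ℝ) ≤ 150 * A.queries := by
  classical
  have : ∀ m : Fin n × Fin n, Fintype (shiftSumSubgroup q m) := fun m => Fintype.ofFinite _
  have : Fintype (⊤ : AddSubgroup (Fin 3 × Fin n → ZMod q)) := Fintype.ofFinite _
  have hn : (0 : ℝ) < n := Nat.cast_pos.2 (NeZero.pos n)
  have hR' : (0 : ℝ) < R := Nat.cast_pos.2 hR0
  set c : (Fin n × Fin n) → (Fin 3 × Fin n → ZMod q) → ℝ := adversaryCoeff n q R with hc
  have hS : ∀ m κ, κ ∉ sparseChars q m → c m κ = 0 := fun m κ h => if_neg h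
  have hd := distinctOn_sparseChars (n := n) (q := q)
  have h0 : ∀ m : Fin n × Fin n, (0 : Fin 3 × Fin n → ZMod q) ∈ sparseChars q m :=
    fun m p p' _ => Or.inl rfl
  let v : threeShiftSumNeg n q → (⊤ : AddSubgroup (Fin 3 × Fin n → ZMod q)) :=
    fun y => ⟨y.1, trivial⟩
  have hv : Function.Injective v := fun y y' h => Subtype.ext (congrArg (fun z => z.1) h)
  -- The value of this bound is immaterial: it only guarantees that the norm is finite.
  have hC : KernelBound (fun r y => charKernel (shiftSumSubgroup q) c r (v y)) R := by
    refine (kernelBound_charKernel (shiftSumSubgroup q) c hS hd hR'.le fun κ => ?_).comp_injective hv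
    have hle : ∀ m : Fin n × Fin n, c m κ ^ 2 ≤ (R / n : ℝ) ^ 2 := by
      intro m
      simp only [hc, adversaryCoeff]
      split_ifs
      · gcongr
        exact Nat.sub_le _ _
      · simpa using sq_nonneg _
    calc _ ≤ ∑ _m : Fin n × Fin n, (R / n : ℝ) ^ 2 := Finset.sum_le_sum fun m _ => hle m
      _ = (R : ℝ) ^ 2 := by
        simp [Finset.card_univ]
        field_simp
  -- `3 / 2` is a rational upper bound for `√2`.
  have hL : ∀ i k, KernelBound (fun (r : Σ m, shiftSumSubgroup q m) y =>
      charKernel (shiftSumSubgroup q) c r (v y) *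
        (1 - ZMod.stdAddChar (k * (r.2.1 i - y.1 i)))) (3 / 2 + 3 / 2) := fun i k =>
    (kernelBound_charKernel_mul_one_sub (shiftSumSubgroup q) c hS hd i k (by norm_num)
      fun κ => (sum_adversaryCoeff_sub_sq_le hR (j := i) fun p hp => by
        simp [Pi.single_eq_of_ne hp]).trans (by norm_num)).comp_injective hv
  let N : ℝ := Fintype.card (threeShiftSumNeg n q)
  let X : ℝ := Fintype.card (Fin 3 × Fin n → ZMod q)
  have hX : 0 < X := Nat.cast_pos.2 Fintype.card_pos
  have hXN : X ≤ 2 * N := by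
    have h := card_le_two_mul_card_neg hq
    simp only [X, N]
    exact_mod_cast h
  have hN : 0 < N := by linarith
  have hH : ∀ m : Fin n × Fin n, (0 : ℝ) < Fintype.card (shiftSumSubgroup q m) :=
    fun m => Nat.cast_pos.2 Fintype.card_pos
  -- Constant on each block, with squared mass `1 / n ^ 2` per shift, so that the form sees only the
  -- trivial character.
  let w : Fin n × Fin n → ℝ := fun m => (n * √(Fintype.card (shiftSumSubgroup q m)))⁻¹
  let f : (Σ m : Fin n × Fin n, shiftSumSubgroup q m) → ℂ := fun r => (w r.1 : ℂ)
  let g : threeShiftSumNeg n q → ℂ := fun _ => ((√N)⁻¹ : ℝ)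
  have hf : ∑ r, ‖f r‖ ^ 2 = 1 := by
    have h1 : ∀ m : Fin n × Fin n,
        (Fintype.card (shiftSumSubgroup q m) : ℝ) * w m ^ 2 = ((n : ℝ) ^ 2)⁻¹ := by
      intro m
      have := (hH m).ne'
      rw [inv_pow, mul_pow, Real.sq_sqrt (hH m).le]
      field_simp
    rw [sum_sigma_norm_ofReal_sq, Finset.sum_congr rfl fun m _ => h1 m, Finset.sum_const,
      Finset.card_univ, Fintype.card_prod, Fintype.card_fin, nsmul_eq_mul]
    push_cast
    field_simp
  have hg : ∑ y, ‖g y‖ ^ 2 = 1 := by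
    have h1 : ∀ y, ‖g y‖ ^ 2 = N⁻¹ := by
      intro y
      rw [Complex.norm_real, Real.norm_eq_abs, sq_abs, inv_pow, Real.sq_sqrt hN.le]
    rw [Finset.sum_congr rfl fun y _ => h1 y, Finset.sum_const, Finset.card_univ, nsmul_eq_mul]
    exact mul_inv_cancel₀ hN.ne'
  have hfg : kernelForm (fun r y => charKernel (shiftSumSubgroup q) c r (v y)) f g =
      ((R * (√N * (√X)⁻¹) : ℝ) : ℂ) := by
    rw [kernelForm_charKernel_const (shiftSumSubgroup q) c hS hd h0 v w]
    congr 1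
    have h1 : ∀ m : Fin n × Fin n,
        w m * (c m 0 * √(Fintype.card (shiftSumSubgroup q m)) * (√X)⁻¹) =
          R * ((n : ℝ) ^ 2)⁻¹ * (√X)⁻¹ := by
      intro m
      have hs : √(Fintype.card (shiftSumSubgroup q m) : ℝ) ≠ 0 := (Real.sqrt_pos.2 (hH m)).ne'
      rw [hc, adversaryCoeff_zero]
      simp only [w]
      field_simp
    rw [Finset.sum_congr rfl fun m _ => h1 m, Finset.sum_const,
      Finset.card_univ, Fintype.card_prod, Fintype.card_fin, nsmul_eq_mul]
    have h2 : N * (√N)⁻¹ = √N := by rw [← div_eq_mul_inv, Real.div_sqrt]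
    change _ * (N * (√N)⁻¹) = _
    rw [h2]
    push_cast
    field_simp
  -- `7 / 10` lies just below `√(1 / 2)`, and `N / X ≥ 1 / 2`.
  have hval : (7 / 10 : ℝ) ≤ √N * (√X)⁻¹ := by
    rw [← div_eq_mul_inv, ← Real.sqrt_div hN.le]
    refine Real.le_sqrt_of_sq_le ?_
    rw [le_div_iff₀ hX]
    linarith
  have hK : (R : ℝ) * (7 / 10) ≤
      ‖kernelForm (fun r y => charKernel (shiftSumSubgroup q) c r (v y)) f g‖ := by
    rw [hfg, Complex.norm_real]
    exact (mul_le_mul_of_nonneg_left hval hR'.le).trans (le_abs_self _)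
  have hpos : ∀ r : Σ m : Fin n × Fin n, shiftSumSubgroup q m, 2 / 3 ≤ A.acceptProb r.2.1 :=
    fun r => hA.1 _ (shiftSumSubgroup_subset_pos r.1 r.2.2)
  have hneg : ∀ y : threeShiftSumNeg n q, A.acceptProb y.1 ≤ 1 / 3 := fun y => hA.2 _ y.2
  have hK0 : 0 < (R : ℝ) * (7 / 10) := by positivity
  have hL0 : (0 : ℝ) ≤ 3 / 2 + 3 / 2 := by norm_num
  have h := A.le_queries_of_kernelBound _ _ hpos hneg _ hC hK0 hL0 hL f g hf hg hK
  linarith only [h]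

end Main

theorem mainTheorem2 :
    ∃ c : ℝ, 0 < c ∧ ∀ (n q : ℕ) [NeZero n] [NeZero q], 2 * n ^ 3 ≤ q →
      ENNReal.ofReal (c * (n : ℝ) ^ ((1 : ℝ) / 3)) ≤
        (quantumQueryComplexity (threeShiftSumPos n q) (threeShiftSumNeg n q) : ℝ≥0∞) := by
  -- `R ≤ 150 * queries` with `R = ⌊s⌋₊ ≥ s / 2`, where `s = n ^ (1 / 3) ≥ 1`.
  refine ⟨1 / 300, by norm_num, fun n q _ _ hq => ?_⟩
  have hn : (1 : ℝ) ≤ n := Nat.one_le_cast.2 (NeZero.pos n)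
  set s : ℝ := (n : ℝ) ^ ((1 : ℝ) / 3) with hs
  have hs1 : 1 ≤ s := Real.one_le_rpow hn (by norm_num)
  have hs3 : s ^ 3 = n := by
    rw [hs, ← Real.rpow_natCast, ← Real.rpow_mul (by positivity)]
    norm_num
  have hR0 : 0 < ⌊s⌋₊ := Nat.floor_pos.2 hs1
  have hR : ⌊s⌋₊ ^ 3 ≤ n := by
    have : (⌊s⌋₊ : ℝ) ^ 3 ≤ n := by
      rw [← hs3]
      gcongr
      exact Nat.floor_le (by positivity)
    exact_mod_cast this
  have hlt : s < ⌊s⌋₊ + 1 := Nat.lt_floor_add_one s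
  have hone : (1 : ℝ) ≤ ⌊s⌋₊ := Nat.one_le_cast.2 hR0
  -- Query counts are integers, so the real bound can be rounded up and the comparison made in `ℕ∞`.
  have key : (⌈1 / 300 * s⌉₊ : ℕ∞) ≤
      quantumQueryComplexity (threeShiftSumPos n q) (threeShiftSumNeg n q) := by
    refine le_iInf₂ fun A hA => ?_
    have h := A.le_queries_of_threeShiftSum hq hR0 hR hA
    refine Nat.cast_le.2 (Nat.ceil_le.2 ?_)
    linarith
  calc ENNReal.ofReal (1 / 300 * s) ≤ ENNReal.ofReal (⌈1 / 300 * s⌉₊ : ℝ) :=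
        ENNReal.ofReal_le_ofReal (Nat.le_ceil _)
    _ = ((⌈1 / 300 * s⌉₊ : ℕ∞) : ℝ≥0∞) := by simp
    _ ≤ _ := ENat.toENNReal_le.2 key
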